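/- Let $k$ be a field and $S=k[x_1,\dots,x_n]$ with the standard grading, and let $\mathfrak m=(x_1,\dots,x_n)$. A finitely generated graded $S$-module $M$ is said to have *initially linear syzygies* if there are finitely many homogeneous generators $m_1,\dots,m_r$ of $M$ and a term order $\prec$ on the free module $F=\bigoplus_{i=1}^r S\cdot g_i$ such that, for the surjection $\eta\colon F\to M$ with $\eta(g_i)=m_i$, one has $\ker\eta\subseteq\bigoplus_i\mathfrak m\cdot g_i$, and the initial module $\mathrm{in}_\prec(\ker\eta)$ is generated by terms of the form $x_j g_i$. Theorem. Suppose that the finitely generated graded $S$-module $M$ has initially linear syzygies. Then for every $d\in\mathbb Z$ the submodule $M_{\langle d\rangle}\subseteq M$ generated by all homogeneous elements of degree $d$ in $M$, with the grading inherited from $M$, also has initially linear syzygies. -/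

import Mathlib

open MvPolynomial

/-- `𝓜` is a `ℤ`-grading of the module `M` over the standard graded polynomial ring
`S = k[x_1, …, x_n]`: `M` is the internal direct sum of the groups `𝓜 j`, and `S_i 𝓜_j ⊆ 𝓜_{i+j}`
(so that each `𝓜 j` is a `k`-subspace). -/
structure IsGradedModule {k : Type*} [Field k] {n : ℕ} {M : Type*} [AddCommGroup M]
    [Module (MvPolynomial (Fin n) k) M] (𝓜 : ℤ → AddSubgroup M) : Prop where
  isInternal : DirectSum.IsInternal 𝓜
  smul_mem : ∀ (i : ℕ) (j : ℤ) (p : MvPolynomial (Fin n) k) (m : M),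
    p.IsHomogeneous i → m ∈ 𝓜 j → p • m ∈ 𝓜 (i + j)

/-- The grading of a submodule `N` of `M` inherited from `M`: `N_j = N ∩ M_j`. -/
def inheritedGrading {R : Type*} [CommRing R] {M : Type*} [AddCommGroup M] [Module R M]
    (𝓜 : ℤ → AddSubgroup M) (N : Submodule R M) : ℤ → AddSubgroup N :=
  fun j => (𝓜 j).comap N.subtype.toAddMonoidHom

/-- The submodule `M_⟨d⟩` generated by the homogeneous elements of degree `d`. -/
def degreeComponent (R : Type*) [CommRing R] {M : Type*} [AddCommGroup M] [Module R M]
    (𝓜 : ℤ → AddSubgroup M) (d : ℤ) : Submodule R M :=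
  Submodule.span R (𝓜 d : Set M)

/-- The inherited grading of `M_⟨d⟩` is a grading. -/
theorem IsGradedModule.degreeComponent {k : Type*} [Field k] {n : ℕ} {M : Type*} [AddCommGroup M]
    [Module (MvPolynomial (Fin n) k) M] {𝓜 : ℤ → AddSubgroup M}
    (h : IsGradedModule (k := k) (n := n) 𝓜) (d : ℤ) :
    IsGradedModule (k := k) (n := n)
      (inheritedGrading 𝓜 (degreeComponent (MvPolynomial (Fin n) k) 𝓜 d)) := by
  set N := _root_.degreeComponent (MvPolynomial (Fin n) k) 𝓜 d with hN
  refine ⟨⟨?_, ?_⟩, fun i j p m hp hm => h.smul_mem i j p m hp hm⟩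
  · rw [injective_iff_map_eq_zero]
    intro a ha
    let F : ∀ j, inheritedGrading 𝓜 N j →+ 𝓜 j := fun j =>
      { toFun := fun x => ⟨x.1.1, x.2⟩, map_zero' := rfl, map_add' := fun _ _ => rfl }
    have key : (DirectSum.coeAddMonoidHom 𝓜).comp (DirectSum.map F) =
        N.subtype.toAddMonoidHom.comp (DirectSum.coeAddMonoidHom (inheritedGrading 𝓜 N)) := by
      ext j x
      simp [F]
    have h0 : DirectSum.map F a = 0 := by
      apply h.isInternal.1
      have := DFunLike.congr_fun key a
      simpa [ha] using this
    ext j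
    have := congrArg (fun z => ((z j : 𝓜 j) : M)) h0
    simpa [F, DirectSum.map_apply] using this
  · have : ∀ x (hx : x ∈ N), (⟨x, hx⟩ : N) ∈
        AddMonoidHom.range (DirectSum.coeAddMonoidHom (inheritedGrading 𝓜 N)) := by
      have hom : ∀ (p : MvPolynomial (Fin n) k) (y : N) (_ : (y : M) ∈ 𝓜 d), p • y ∈
          AddMonoidHom.range (DirectSum.coeAddMonoidHom (inheritedGrading 𝓜 N)) := by
        intro p y hy
        rw [← p.sum_homogeneousComponent, Finset.sum_smul]
        refine sum_mem fun i _ => ?_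
        refine ⟨DirectSum.of (fun j => inheritedGrading 𝓜 N j) (i + d)
          ⟨p.homogeneousComponent i • y, ?_⟩, by simp⟩
        exact h.smul_mem i d _ _ (homogeneousComponent_isHomogeneous i p) hy
      intro x hx
      obtain ⟨c, hc, rfl⟩ := (Submodule.mem_span_set (R := MvPolynomial (Fin n) k)).1 hx
      have e : (⟨_, hx⟩ : N) = ∑ y : c.support,
          c y • (⟨y, Submodule.subset_span (hc y.2)⟩ : N) := by
        ext
        simpa [Finsupp.sum] using (Finset.sum_attach c.support (fun y => c y • y)).symm
      rw [e]
      exact sum_mem fun y _ => hom _ _ (hc y.2)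
    rintro ⟨x, hx⟩
    exact this x hx

/-- A term order on the free module with basis `(g_i)_{i : ι}` over the polynomial ring in the
variables `σ`, as a strict order. The pair `(α, i)` stands for the term `x^α g_i`. A term order is
a well-order on the terms that is compatible with multiplication by monomials. -/
structure IsTermOrder {σ ι : Type*}
    (lt : (σ →₀ ℕ) × ι → (σ →₀ ℕ) × ι → Prop) : Prop where
  isWellOrder : IsWellOrder ((σ →₀ ℕ) × ι) lt
  mul_lt_mul : ∀ (γ α β : σ →₀ ℕ) (i j : ι), lt (α, i) (β, j) → lt (γ + α, i) (γ + β, j)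

/-- The term `x^α g_i` occurs in `f` and is larger than all other terms that occur in `f`. -/
def IsInitialTerm {k : Type*} [Field k] {σ ι : Type*}
    (lt : (σ →₀ ℕ) × ι → (σ →₀ ℕ) × ι → Prop)
    (f : ι →₀ MvPolynomial σ k) (t : (σ →₀ ℕ) × ι) : Prop :=
  coeff t.1 (f t.2) ≠ 0 ∧ ∀ s : (σ →₀ ℕ) × ι, coeff s.1 (f s.2) ≠ 0 → s ≠ t → lt s t

/-- The initial module `in(K)` of a submodule `K` of a free module, generated by the initial terms
of the (nonzero) elements of `K`. -/
noncomputable def initialModule {k : Type*} [Field k] {σ ι : Type*}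
    (lt : (σ →₀ ℕ) × ι → (σ →₀ ℕ) × ι → Prop)
    (K : Submodule (MvPolynomial σ k) (ι →₀ MvPolynomial σ k)) :
    Submodule (MvPolynomial σ k) (ι →₀ MvPolynomial σ k) :=
  Submodule.span (MvPolynomial σ k)
    {v | ∃ f ∈ K, ∃ t : (σ →₀ ℕ) × ι, IsInitialTerm lt f t ∧
      v = Finsupp.single t.2 (monomial t.1 1)}

/-- The presentation `0 → ker η → ⨁ S g_i → M → 0`, where `η` sends the `i`-th basis element to
`g i`, has initially linear syzygies with respect to the term order `lt`. -/
structure IsInitiallyLinearPresentation {k : Type*} [Field k] {n : ℕ} {M : Type*} [AddCommGroup M]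
    [Module (MvPolynomial (Fin n) k) M] (𝓜 : ℤ → AddSubgroup M) {r : ℕ} (g : Fin r → M)
    (lt : (Fin n →₀ ℕ) × Fin r → (Fin n →₀ ℕ) × Fin r → Prop) : Prop where
  isTermOrder : IsTermOrder lt
  homogeneous : ∀ i, ∃ j, g i ∈ 𝓜 j
  span_eq_top : Submodule.span (MvPolynomial (Fin n) k) (Set.range g) = ⊤
  /-- `ker η ⊆ ⨁ 𝔪 g_i` with `𝔪 = (x_1, …, x_n)` -/
  minimal : ∀ f ∈ LinearMap.ker (Finsupp.linearCombination (MvPolynomial (Fin n) k) g),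
    ∀ i, f i ∈ idealOfVars (Fin n) k
  /-- `in(ker η)` is generated by terms of the form `x_j g_i` -/
  initiallyLinear : ∃ T : Set (Fin n × Fin r),
    initialModule lt (LinearMap.ker (Finsupp.linearCombination (MvPolynomial (Fin n) k) g)) =
      Submodule.span (MvPolynomial (Fin n) k)
        ((fun p : Fin n × Fin r =>
          (Finsupp.single p.2 (X p.1) : Fin r →₀ MvPolynomial (Fin n) k)) '' T)

/-- `M`, graded by `𝓜`, has initially linear syzygies: some presentation by finitely many
homogeneous generators has them, for some term order. -/
def HasInitiallyLinearSyzygies (k : Type*) [Field k] (n : ℕ) {M : Type*} [AddCommGroup M]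
    [Module (MvPolynomial (Fin n) k) M] (𝓜 : ℤ → AddSubgroup M) : Prop :=
  ∃ (r : ℕ) (g : Fin r → M) (lt : (Fin n →₀ ℕ) × Fin r → (Fin n →₀ ℕ) × Fin r → Prop),
    IsInitiallyLinearPresentation (k := k) 𝓜 g lt

/-! Let the initial module of the given syzygies be generated by the `x_j g_i` with `(j, i) ∈ T`. By
Macaulay's argument the standard terms, divisible by no such `x_j g_i`, represent a `k`-basis of
`M`. Those of degree `d`, enumerated by `b`, serve as generators of `M_⟨d⟩`. Independence makes this
presentation minimal (`termCoeff_zero_eq_zero`). Terms `x^α e_a` of the new free module are ordered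
by the old term `x^α · b a`, with ties broken lexicographically on the monomial in `b a`.

Let `b a` lie in component `i`. Two kinds of syzygy have a linear initial term `x_j e_a`. If `(j, i)
∈ T`, then `x_j · b a` leads a multiple of an old linear syzygy. By minimality each tail term is a
variable times a term of degree `d`, and the latter reduces to standard terms
(`exists_lift_of_mem`). If `(j, i) ∉ T` and `x_l` divides `b a` for some `l < j`, then `x_j · b a =
x_l · (x_j b a / x_l)`, and the second factor is again standard but lexicographically smaller
(`exists_lift_of_lt`).

These syzygies suffice (`exists_dvd_pushOrder`). If the initial term of a syzygy shares its old term
with another term of the syzygy, the lexicographic tie-break produces a swap. Otherwise it survives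
as an initial term of an old syzygy, hence is divisible by some `x_j` coming from `T`. This `x_j`
cannot divide the standard `b a`, so it divides the coefficient. -/

/-! ### Terms, initial terms and monomial submodules -/

section Terms

variable {k σ ι : Type*} [Field k]

/-- The term `x^α g_i` as an element of the free module. -/
noncomputable def term (k : Type*) [Field k] {σ ι : Type*} (t : (σ →₀ ℕ) × ι) :
    ι →₀ MvPolynomial σ k :=
  Finsupp.single t.2 (monomial t.1 1)

/-- The coefficient of the term `t` in `f`. -/
noncomputable def termCoeff (f : ι →₀ MvPolynomial σ k) (t : (σ →₀ ℕ) × ι) : k :=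
  coeff t.1 (f t.2)

theorem termCoeff_add (f g : ι →₀ MvPolynomial σ k) (t : (σ →₀ ℕ) × ι) :
    termCoeff (f + g) t = termCoeff f t + termCoeff g t := by
  simp [termCoeff]

theorem termCoeff_sub (f g : ι →₀ MvPolynomial σ k) (t : (σ →₀ ℕ) × ι) :
    termCoeff (f - g) t = termCoeff f t - termCoeff g t := by
  simp [termCoeff]

theorem termCoeff_term [DecidableEq ((σ →₀ ℕ) × ι)] (s t : (σ →₀ ℕ) × ι) :
    termCoeff (term k s) t = if s = t then 1 else 0 := by
  classical
  obtain ⟨α, i⟩ := s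
  obtain ⟨β, j⟩ := t
  by_cases h : i = j
  · subst h; simp [termCoeff, term, coeff_monomial]
  · simp [termCoeff, term, h]

theorem termCoeff_monomial_smul (f : ι →₀ MvPolynomial σ k) (γ : σ →₀ ℕ) (c : k)
    (t : (σ →₀ ℕ) × ι) :
    termCoeff (monomial γ c • f) (γ + t.1, t.2) = c * termCoeff f t := by
  simp [termCoeff, coeff_monomial_mul]

theorem exists_of_termCoeff_monomial_smul_ne_zero {f : ι →₀ MvPolynomial σ k} {γ : σ →₀ ℕ} {c : k}
    {s : (σ →₀ ℕ) × ι} (h : termCoeff (monomial γ c • f) s ≠ 0) :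
    ∃ t : (σ →₀ ℕ) × ι, s = (γ + t.1, t.2) ∧ termCoeff f t ≠ 0 := by
  classical
  obtain ⟨α, i⟩ := s
  have hle : γ ≤ α := by
    by_contra hle
    simp [termCoeff, coeff_monomial_mul', hle] at h
  obtain ⟨β, rfl⟩ := exists_add_of_le hle
  refine ⟨(β, i), rfl, fun h0 => h ?_⟩
  have := termCoeff_monomial_smul f γ c (β, i)
  rw [h0, mul_zero] at this
  exact this

theorem finite_termCoeff_ne_zero (f : ι →₀ MvPolynomial σ k) :
    {s : (σ →₀ ℕ) × ι | termCoeff f s ≠ 0}.Finite := by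
  classical
  refine (f.support.biUnion fun i => (f i).support.image fun α => (α, i)).finite_toSet.subset ?_
  rintro ⟨α, i⟩ h
  have h' : coeff α (f i) ≠ 0 := h
  simp only [Finset.coe_biUnion, Set.mem_iUnion, Finset.mem_coe, Finset.coe_image]
  refine ⟨i, ?_, α, ?_, rfl⟩
  · rw [Finsupp.mem_support_iff]
    intro h0
    simp [h0] at h'
  · simpa using h'

theorem mem_of_forall_term_mem (P : Submodule k (ι →₀ MvPolynomial σ k))
    {f : ι →₀ MvPolynomial σ k} (h : ∀ s, termCoeff f s ≠ 0 → term k s ∈ P) : f ∈ P := by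
  rw [← f.sum_single]
  refine sum_mem fun i _ => ?_
  have e : Finsupp.single i (f i) =
      ∑ α ∈ (f i).support, coeff α (f i) • term k (α, i) := by
    conv_lhs => rw [← support_sum_monomial_coeff (f i)]
    rw [← Finsupp.singleAddHom_apply, map_sum]
    refine Finset.sum_congr rfl fun α _ => ?_
    simp [term, smul_monomial]
  rw [e]
  exact sum_mem fun α hα => P.smul_mem _ (h (α, i) (by simpa [termCoeff] using hα))

theorem eq_zero_of_termCoeff {f : ι →₀ MvPolynomial σ k} (h : ∀ s, termCoeff f s = 0) : f = 0 := by
  ext i α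
  simpa [termCoeff] using h (α, i)

theorem IsTermOrder.exists_isInitialTerm {lt : (σ →₀ ℕ) × ι → (σ →₀ ℕ) × ι → Prop}
    (hlt : IsTermOrder lt) {f : ι →₀ MvPolynomial σ k} (hf : f ≠ 0) :
    ∃ t, IsInitialTerm lt f t := by
  have := hlt.isWellOrder
  let := IsWellOrder.linearOrder lt
  have hne : (finite_termCoeff_ne_zero f).toFinset.Nonempty := by
    by_contra hne
    refine hf (eq_zero_of_termCoeff fun s => ?_)
    by_contra hs
    exact hne ⟨s, by simpa using hs⟩
  refine ⟨_, by simpa [termCoeff] using Finset.max'_mem _ hne, fun s hs hst => ?_⟩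
  exact lt_of_le_of_ne (Finset.le_max' _ _ (by simpa [termCoeff] using hs)) hst

/-- Multiplication by polynomials keeps the component and only raises exponents, so divisibility by
a generator propagates to every term that occurs in the span. -/
theorem exists_le_of_mem_span_term {A : Set ((σ →₀ ℕ) × ι)} {v : ι →₀ MvPolynomial σ k}
    (hv : v ∈ Submodule.span (MvPolynomial σ k) (term k '' A)) {s : (σ →₀ ℕ) × ι}
    (hs : termCoeff v s ≠ 0) : ∃ t ∈ A, t.2 = s.2 ∧ t.1 ≤ s.1 := by
  classical
  induction hv using Submodule.span_induction generalizing s with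
  | mem x h =>
    obtain ⟨t, ht, rfl⟩ := h
    rw [termCoeff_term] at hs
    obtain rfl : t = s := by by_contra h; simp [h] at hs
    exact ⟨t, ht, rfl, le_rfl⟩
  | zero => simp [termCoeff] at hs
  | add x y _ _ hx hy =>
    rw [termCoeff_add] at hs
    by_cases h : termCoeff x s = 0
    · exact hy (by simpa [h] using hs)
    · exact hx h
  | smul a x _ hx =>
    have : ∃ p ∈ Finset.HasAntidiagonal.antidiagonal s.1, coeff p.1 a * coeff p.2 (x s.2) ≠ 0 := by
      by_contra! h
      apply hs
      simp [termCoeff, coeff_mul, Finset.sum_eq_zero h]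
    obtain ⟨p, hp, h⟩ := this
    obtain ⟨t, ht, h2, h1⟩ := hx (s := (p.2, s.2)) (right_ne_zero_of_mul h)
    rw [Finset.HasAntidiagonal.mem_antidiagonal] at hp
    exact ⟨t, ht, h2, h1.trans (by rw [← hp]; exact le_add_self)⟩

theorem term_mem_span_of_le {A : Set ((σ →₀ ℕ) × ι)} {s t : (σ →₀ ℕ) × ι} (ht : t ∈ A)
    (h2 : t.2 = s.2) (h1 : t.1 ≤ s.1) :
    term k s ∈ Submodule.span (MvPolynomial σ k) (term k '' A) := by
  obtain ⟨β, i⟩ := t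
  obtain ⟨α, j⟩ := s
  obtain rfl : i = j := h2
  obtain ⟨γ, rfl⟩ := exists_add_of_le h1
  have e : term k (β + γ, i) = monomial γ (1 : k) • term k (β, i) := by
    simp [term, monomial_mul, add_comm]
  rw [e]
  exact Submodule.smul_mem _ _ (Submodule.subset_span ⟨_, ht, rfl⟩)

theorem initialModule_eq (lt : (σ →₀ ℕ) × ι → (σ →₀ ℕ) × ι → Prop)
    (K : Submodule (MvPolynomial σ k) (ι →₀ MvPolynomial σ k)) :
    initialModule lt K = Submodule.span (MvPolynomial σ k)
      (term k '' {t | ∃ f ∈ K, IsInitialTerm lt f t}) := by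
  unfold initialModule
  congr 1
  ext v
  constructor
  · rintro ⟨f, hf, t, ht, rfl⟩
    exact ⟨t, ⟨f, hf, ht⟩, rfl⟩
  · rintro ⟨t, ⟨f, hf, ht⟩, rfl⟩
    exact ⟨f, hf, t, ht, rfl⟩

theorem span_linear_terms_eq (T : Set (σ × ι)) :
    Submodule.span (MvPolynomial σ k)
      ((fun p : σ × ι => (Finsupp.single p.2 (X p.1) : ι →₀ MvPolynomial σ k)) '' T) =
    Submodule.span (MvPolynomial σ k)
      (term k '' ((fun p : σ × ι => (Finsupp.single p.1 1, p.2)) '' T)) := by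
  rw [Set.image_image]
  rfl

/-- The initial module is generated by the linear terms `x_j g_i`, `(j, i) ∈ T`, as soon as
these are initial terms and every initial term is divisible by one of them. -/
theorem initialModule_eq_span_linear {lt : (σ →₀ ℕ) × ι → (σ →₀ ℕ) × ι → Prop}
    {K : Submodule (MvPolynomial σ k) (ι →₀ MvPolynomial σ k)} {T : Set (σ × ι)}
    (h1 : ∀ p ∈ T, ∃ f ∈ K, IsInitialTerm lt f (Finsupp.single p.1 1, p.2))
    (h2 : ∀ f ∈ K, ∀ t, IsInitialTerm lt f t → ∃ j, (j, t.2) ∈ T ∧ t.1 j ≠ 0) :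
    initialModule lt K = Submodule.span (MvPolynomial σ k)
      ((fun p : σ × ι => (Finsupp.single p.2 (X p.1) : ι →₀ MvPolynomial σ k)) '' T) := by
  rw [initialModule_eq, span_linear_terms_eq]
  apply le_antisymm
  · rw [Submodule.span_le]
    rintro _ ⟨t, ⟨f, hf, ht⟩, rfl⟩
    obtain ⟨j, hj, hj0⟩ := h2 f hf t ht
    refine term_mem_span_of_le (Set.mem_image_of_mem _ hj) rfl ?_
    simpa [Nat.one_le_iff_ne_zero] using hj0
  · apply Submodule.span_mono
    apply Set.image_mono
    rintro _ ⟨p, hp, rfl⟩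
    exact h1 p hp

/-- Conversely, a term order for which the initial module is generated by the terms `x_j g_i`,
`(j, i) ∈ T`, has these as initial terms, if the module lies in `⨁ 𝔪 g_i`, and every initial
term is divisible by one of them. -/
theorem linear_terms_of_initialModule_eq {lt : (σ →₀ ℕ) × ι → (σ →₀ ℕ) × ι → Prop}
    {K : Submodule (MvPolynomial σ k) (ι →₀ MvPolynomial σ k)} {T : Set (σ × ι)}
    (hmin : ∀ f ∈ K, ∀ i, termCoeff f (0, i) = 0)
    (h : initialModule lt K = Submodule.span (MvPolynomial σ k)
      ((fun p : σ × ι => (Finsupp.single p.2 (X p.1) : ι →₀ MvPolynomial σ k)) '' T)) :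
    (∀ p ∈ T, ∃ f ∈ K, IsInitialTerm lt f (Finsupp.single p.1 1, p.2)) ∧
    (∀ f ∈ K, ∀ t, IsInitialTerm lt f t → ∃ j, (j, t.2) ∈ T ∧ t.1 j ≠ 0) := by
  classical
  rw [initialModule_eq, span_linear_terms_eq] at h
  constructor
  · rintro ⟨j, i⟩ hp
    have hmem : term k (Finsupp.single j 1, i) ∈ Submodule.span (MvPolynomial σ k)
        (term k '' {t | ∃ f ∈ K, IsInitialTerm lt f t}) := by
      rw [h]
      exact Submodule.subset_span ⟨_, Set.mem_image_of_mem _ hp, rfl⟩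
    obtain ⟨⟨α, i'⟩, ⟨f, hf, ht⟩, h2, h1⟩ :=
      exists_le_of_mem_span_term hmem (s := (Finsupp.single j 1, i)) (by simp [termCoeff_term])
    obtain rfl : i' = i := h2
    -- A divisor of `x_j` is `1` or `x_j`; minimality of the presentation excludes `1`.
    have hα : α = Finsupp.single j 1 := by
      have hα0 : α ≠ 0 := by
        rintro rfl
        exact ht.1 (hmin f hf i')
      have hle : α ≤ Finsupp.single j 1 := h1
      refine le_antisymm hle ?_
      have hsup : ∀ l, l ≠ j → α l = 0 := fun l hl => by
        have := hle l
        simpa [Finsupp.single_apply, hl.symm] using this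
      have : α j ≠ 0 := fun h0 => hα0 (by
        ext l
        by_cases hl : l = j
        · simpa [hl] using h0
        · exact hsup l hl)
      simpa [Nat.one_le_iff_ne_zero] using this
    subst hα
    exact ⟨f, hf, ht⟩
  · intro f hf t ht
    have hmem : term k t ∈ Submodule.span (MvPolynomial σ k)
        (term k '' ((fun p : σ × ι => (Finsupp.single p.1 1, p.2)) '' T)) := by
      rw [← h]
      exact Submodule.subset_span ⟨t, ⟨f, hf, ht⟩, rfl⟩
    obtain ⟨_, ⟨⟨j, i⟩, hp, rfl⟩, h2, h1⟩ :=
      exists_le_of_mem_span_term hmem (s := t) (by simp [termCoeff_term])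
    obtain rfl : i = t.2 := h2
    exact ⟨j, hp, by simpa [Nat.one_le_iff_ne_zero] using h1⟩

theorem mem_idealOfVars_iff {p : MvPolynomial σ k} : p ∈ idealOfVars σ k ↔ coeff 0 p = 0 := by
  rw [← pow_one (idealOfVars σ k), mem_pow_idealOfVars_iff']
  simp [Finsupp.degree_eq_zero_iff]

end Terms

/-! ### Homogeneous components in `M` and in its presentations -/

section Grading

variable {k : Type*} [Field k] {n : ℕ} {M : Type*} [AddCommGroup M]
  [Module (MvPolynomial (Fin n) k) M]

/-- The homogeneous component of integral degree `e`, zero if `e < 0`. -/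
noncomputable def intHomogeneousComponent {σ : Type*} (e : ℤ) :
    MvPolynomial σ k →ₗ[k] MvPolynomial σ k :=
  if 0 ≤ e then homogeneousComponent e.toNat else 0

theorem coeff_intHomogeneousComponent {σ : Type*} (e : ℤ) (p : MvPolynomial σ k) (α : σ →₀ ℕ) :
    coeff α (intHomogeneousComponent e p) = if (α.degree : ℤ) = e then coeff α p else 0 := by
  unfold intHomogeneousComponent
  by_cases h : 0 ≤ e
  · have : α.degree = e.toNat ↔ (α.degree : ℤ) = e := by omega
    simp [h, coeff_homogeneousComponent, this]
  · have : ¬ (α.degree : ℤ) = e := by omega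
    simp [h, this]

theorem intHomogeneousComponent_monomial {σ : Type*} (e : ℤ) (α : σ →₀ ℕ) (c : k) :
    intHomogeneousComponent e (monomial α c) =
      if (α.degree : ℤ) = e then monomial α c else 0 := by
  classical
  ext β
  rw [coeff_intHomogeneousComponent, coeff_monomial]
  by_cases h : α = β
  · subst h; rw [if_pos rfl]; split_ifs <;> simp
  · split_ifs <;> simp [coeff_monomial, h]

/-- The projection onto the component of degree `e`. -/
theorem IsGradedModule.exists_projection {𝓜 : ℤ → AddSubgroup M}
    (h : IsGradedModule (k := k) (n := n) 𝓜) (e : ℤ) :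
    ∃ π : M →+ M, (∀ x ∈ 𝓜 e, π x = x) ∧
      ∀ (j : ℤ) (x : M) (_ : x ∈ 𝓜 j) (p : MvPolynomial (Fin n) k),
        π (p • x) = intHomogeneousComponent (e - j) p • x := by
  classical
  let E := AddEquiv.ofBijective (DirectSum.coeAddMonoidHom 𝓜) h.isInternal
  let π : M →+ M := ((𝓜 e).subtype.comp (DFinsupp.evalAddMonoidHom e)).comp E.symm.toAddMonoidHom
  have hE : ∀ j (x : M) (hx : x ∈ 𝓜 j), E.symm x = DirectSum.of (fun j => 𝓜 j) j ⟨x, hx⟩ := by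
    intro j x hx
    rw [AddEquiv.symm_apply_eq]
    exact (DirectSum.coeAddMonoidHom_of 𝓜 j ⟨x, hx⟩).symm
  have hπ : ∀ j (x : M), x ∈ 𝓜 j → π x = if j = e then x else 0 := by
    intro j x hx
    have : π x = ((E.symm x) e : 𝓜 e) := rfl
    rw [this, hE j x hx]
    by_cases hj : j = e
    · subst hj; simp
    · simp [hj, DirectSum.of_eq_of_ne _ _ _ (Ne.symm hj)]
  refine ⟨π, fun x hx => by simp [hπ e x hx], ?_⟩
  intro j x hx p
  -- Both sides are additive in `p`, and a monomial multiple of `x` is homogeneous.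
  induction p using MvPolynomial.induction_on' with
  | monomial α c =>
    have := h.smul_mem α.degree j (monomial α c) x (isHomogeneous_monomial c rfl) hx
    rw [hπ _ _ this, intHomogeneousComponent_monomial]
    have : (α.degree : ℤ) + j = e ↔ (α.degree : ℤ) = e - j := by omega
    simp only [this]
    split_ifs <;> simp
  | add p q hp hq => simp only [add_smul, map_add, hp, hq]

/-- The degree of the term `x^α g_i`, where `g_i` has degree `deg i`. -/
noncomputable def termDegree {σ ι : Type*} (deg : ι → ℤ) (s : (σ →₀ ℕ) × ι) : ℤ := s.1.degree + deg s.2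

/-- The image of the homogeneous component of degree `e` is the homogeneous component of the
image. -/
theorem IsGradedModule.exists_component {𝓜 : ℤ → AddSubgroup M}
    (h : IsGradedModule (k := k) (n := n) 𝓜) (e : ℤ) :
    ∃ π : M →+ M, (∀ x ∈ 𝓜 e, π x = x) ∧
      ∀ {r : ℕ} (g : Fin r → M) (deg : Fin r → ℤ) (_ : ∀ i, g i ∈ 𝓜 (deg i))
        (f : Fin r →₀ MvPolynomial (Fin n) k), ∃ f' : Fin r →₀ MvPolynomial (Fin n) k,
        Finsupp.linearCombination (MvPolynomial (Fin n) k) g f' =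
          π (Finsupp.linearCombination (MvPolynomial (Fin n) k) g f) ∧
        ∀ s, termCoeff f' s = if termDegree deg s = e then termCoeff f s else 0 := by
  obtain ⟨π, hπ1, hπ⟩ := h.exists_projection e
  refine ⟨π, hπ1, fun {r} g deg hg f => ?_⟩
  refine ⟨Finsupp.equivFunOnFinite.symm fun i => intHomogeneousComponent (e - deg i) (f i), ?_, ?_⟩
  · rw [Finsupp.linearCombination_apply, Finsupp.linearCombination_apply,
      Finsupp.sum_fintype _ _ (by simp), Finsupp.sum_fintype _ _ (by simp), map_sum]
    refine Finset.sum_congr rfl fun i _ => ?_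
    rw [hπ _ _ (hg i)]
    rfl
  · rintro ⟨α, i⟩
    have : termDegree deg (α, i) = e ↔ (α.degree : ℤ) = e - deg i := by
      simp only [termDegree]; omega
    simp only [this]
    exact coeff_intHomogeneousComponent _ _ _

end Grading

/-! ### Standard terms of degree `d` and the free module on them -/

section LinearSyzygies

variable {k : Type*} [Field k] {n r q : ℕ} {M : Type*} [AddCommGroup M]
  [Module (MvPolynomial (Fin n) k) M]

/-- A presentation of a graded module, with generators `g i` of degree `deg i`, for which the
initial module of the syzygies is generated by the terms `x_j g_i`, `(j, i) ∈ T`. -/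
structure HasLinearInitialTerms (k : Type*) [Field k] {n r : ℕ} {M : Type*} [AddCommGroup M]
    [Module (MvPolynomial (Fin n) k) M] (g : Fin r → M) (deg : Fin r → ℤ)
    (lt : (Fin n →₀ ℕ) × Fin r → (Fin n →₀ ℕ) × Fin r → Prop) (T : Set (Fin n × Fin r)) :
    Prop where
  isTermOrder : IsTermOrder lt
  exists_initial : ∀ p ∈ T, ∃ f ∈ LinearMap.ker (Finsupp.linearCombination (MvPolynomial (Fin n) k) g),
    IsInitialTerm lt f (Finsupp.single p.1 1, p.2) ∧
      ∀ s, termCoeff f s ≠ 0 → termDegree deg s = deg p.2 + 1 ∧ s.1 ≠ 0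
  exists_dvd : ∀ f ∈ LinearMap.ker (Finsupp.linearCombination (MvPolynomial (Fin n) k) g),
    ∀ t, IsInitialTerm lt f t → ∃ j, (j, t.2) ∈ T ∧ t.1 j ≠ 0

/-- The terms that are not divisible by any `x_j g_i` with `(j, i) ∈ T`. -/
def IsStandard {σ ι : Type*} (T : Set (σ × ι)) (t : (σ →₀ ℕ) × ι) : Prop :=
  ∀ j, (j, t.2) ∈ T → t.1 j = 0

/-- `b` enumerates the standard terms of degree `d`. -/
structure IsStandardBasis (deg : Fin r → ℤ) (T : Set (Fin n × Fin r)) (d : ℤ)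
    (b : Fin q → (Fin n →₀ ℕ) × Fin r) : Prop where
  injective : Function.Injective b
  isStandard : ∀ a, IsStandard T (b a)
  degree_eq : ∀ a, termDegree deg (b a) = d
  exists_eq : ∀ t, IsStandard T t → termDegree deg t = d → ∃ a, b a = t

theorem exists_isStandardBasis (deg : Fin r → ℤ) (T : Set (Fin n × Fin r)) (d : ℤ) :
    ∃ (q : ℕ) (b : Fin q → (Fin n →₀ ℕ) × Fin r), IsStandardBasis deg T d b := by
  have hfin : {t : (Fin n →₀ ℕ) × Fin r | IsStandard T t ∧ termDegree deg t = d}.Finite := by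
    have h1 : (⋃ i : Fin r, {α : Fin n →₀ ℕ | α.degree ≤ (d - deg i).toNat}).Finite :=
      Set.finite_iUnion fun i => Finsupp.finite_of_degree_le _
    refine (h1.prod (Set.finite_univ (α := Fin r))).subset ?_
    rintro ⟨α, i⟩ ⟨-, h⟩
    refine ⟨Set.mem_iUnion.2 ⟨i, ?_⟩, trivial⟩
    simp only [termDegree, Set.mem_ofPred_eq] at h ⊢
    omega
  have := hfin.to_subtype
  let e := (Finite.equivFin {t : (Fin n →₀ ℕ) × Fin r | IsStandard T t ∧ termDegree deg t = d}).symm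
  exact ⟨_, fun a => (e a).1, Subtype.val_injective.comp e.injective, fun a => (e a).2.1,
    fun a => (e a).2.2, fun t h1 h2 => ⟨e.symm ⟨t, h1, h2⟩,
      congrArg Subtype.val (e.apply_symm_apply ⟨t, h1, h2⟩)⟩⟩

/-- The term `x^α · b a` of the old free module, for the term `(α, a)` of the free module on `b`. -/
noncomputable def pushTerm {σ ι κ : Type*} (b : κ → (σ →₀ ℕ) × ι) (s : (σ →₀ ℕ) × κ) :
    (σ →₀ ℕ) × ι :=
  (s.1 + (b s.2).1, (b s.2).2)

/-- The map of free modules that sends the basis elements to the terms `b a`. -/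
noncomputable def pushMap (k : Type*) [Field k] {σ ι κ : Type*} (b : κ → (σ →₀ ℕ) × ι) :
    (κ →₀ MvPolynomial σ k) →ₗ[MvPolynomial σ k] (ι →₀ MvPolynomial σ k) :=
  Finsupp.linearCombination (MvPolynomial σ k) fun a => term k (b a)

/-- The element `x^α g_i` of the module, for the term `b a = (α, i)`. -/
noncomputable def termGenerator (k : Type*) [Field k] {n r q : ℕ} {M : Type*} [AddCommGroup M]
    [Module (MvPolynomial (Fin n) k) M] (g : Fin r → M) (b : Fin q → (Fin n →₀ ℕ) × Fin r) :
    Fin q → M :=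
  fun a => monomial (b a).1 (1 : k) • g (b a).2

theorem linearCombination_pushMap (g : Fin r → M) (b : Fin q → (Fin n →₀ ℕ) × Fin r)
    (f : Fin q →₀ MvPolynomial (Fin n) k) :
    Finsupp.linearCombination (MvPolynomial (Fin n) k) g (pushMap k b f) =
      Finsupp.linearCombination (MvPolynomial (Fin n) k) (termGenerator k g b) f := by
  rw [← LinearMap.comp_apply]
  congr 1
  ext a
  simp [pushMap, term, termGenerator]

theorem pushMap_term (b : Fin q → (Fin n →₀ ℕ) × Fin r) (s : (Fin n →₀ ℕ) × Fin q) :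
    pushMap k b (term k s) = term k (pushTerm b s) := by
  simp [pushMap, term, pushTerm, monomial_mul]

theorem termCoeff_pushMap (b : Fin q → (Fin n →₀ ℕ) × Fin r)
    (f : Fin q →₀ MvPolynomial (Fin n) k) (t : (Fin n →₀ ℕ) × Fin r) :
    termCoeff (pushMap k b f) t =
      ∑ a, if (b a).2 = t.2 ∧ (b a).1 ≤ t.1 then coeff (t.1 - (b a).1) (f a) else 0 := by
  classical
  rw [pushMap, Finsupp.linearCombination_apply, Finsupp.sum_fintype _ _ (by simp), termCoeff,
    Finsupp.finsetSum_apply, coeff_sum]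
  refine Finset.sum_congr rfl fun a _ => ?_
  by_cases h : (b a).2 = t.2
  · simp [term, h, coeff_mul_monomial']
  · simp [term, h]

theorem exists_of_termCoeff_pushMap_ne_zero {b : Fin q → (Fin n →₀ ℕ) × Fin r}
    {f : Fin q →₀ MvPolynomial (Fin n) k} {t : (Fin n →₀ ℕ) × Fin r}
    (h : termCoeff (pushMap k b f) t ≠ 0) : ∃ s, termCoeff f s ≠ 0 ∧ pushTerm b s = t := by
  rw [termCoeff_pushMap] at h
  obtain ⟨a, -, ha⟩ := Finset.exists_ne_zero_of_sum_ne_zero h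
  split_ifs at ha with hc
  · exact ⟨(t.1 - (b a).1, a), ha, Prod.ext (tsub_add_cancel_of_le hc.2) hc.1⟩
  · exact absurd rfl ha

/-- Distinct terms may be pushed to the same old term and cancel; the hypothesis excludes such
collisions at `s`. -/
theorem termCoeff_pushMap_pushTerm {b : Fin q → (Fin n →₀ ℕ) × Fin r}
    {f : Fin q →₀ MvPolynomial (Fin n) k} {s : (Fin n →₀ ℕ) × Fin q}
    (h : ∀ s', termCoeff f s' ≠ 0 → pushTerm b s' = pushTerm b s → s' = s) :
    termCoeff (pushMap k b f) (pushTerm b s) = termCoeff f s := by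
  rw [termCoeff_pushMap, Finset.sum_eq_single s.2]
  · simp [pushTerm, termCoeff]
  · intro a _ ha
    split_ifs with hc
    · by_contra h0
      exact ha (congrArg Prod.snd (h ((pushTerm b s).1 - (b a).1, a) h0
        (Prod.ext (tsub_add_cancel_of_le hc.2) hc.1)))
    · rfl
  · simp

/-- The elements whose image in `M` is the image of an element of the free module on `b`, all of
whose terms satisfy `P`. -/
noncomputable def liftable (k : Type*) [Field k] {n r q : ℕ} {M : Type*} [AddCommGroup M]
    [Module (MvPolynomial (Fin n) k) M] (g : Fin r → M) (b : Fin q → (Fin n →₀ ℕ) × Fin r)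
    (P : (Fin n →₀ ℕ) × Fin q → Prop) : Submodule k (Fin r →₀ MvPolynomial (Fin n) k) where
  carrier := {f | ∃ y, (∀ s, termCoeff y s ≠ 0 → P s) ∧
    Finsupp.linearCombination (MvPolynomial (Fin n) k) (termGenerator k g b) y =
      Finsupp.linearCombination (MvPolynomial (Fin n) k) g f}
  zero_mem' := ⟨0, by simp [termCoeff], by simp⟩
  add_mem' := by
    rintro f f' ⟨y, hy, hyf⟩ ⟨y', hy', hyf'⟩
    refine ⟨y + y', fun s hs => ?_, by simp [hyf, hyf']⟩
    by_cases h : termCoeff y s = 0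
    · exact hy' s (by simpa [termCoeff_add, h] using hs)
    · exact hy s h
  smul_mem' := by
    rintro c f ⟨y, hy, hyf⟩
    refine ⟨(C c : MvPolynomial (Fin n) k) • y, fun s hs => hy s fun h => hs ?_, ?_⟩
    · have : coeff s.1 (y s.2) = 0 := h
      simp [termCoeff, this]
    · have : c • f = (C c : MvPolynomial (Fin n) k) • f := by
        ext i : 1
        simp [smul_eq_C_mul]
      rw [this, map_smul, map_smul, hyf]

theorem liftable_mono {g : Fin r → M} {b : Fin q → (Fin n →₀ ℕ) × Fin r}
    {P Q : (Fin n →₀ ℕ) × Fin q → Prop} (h : ∀ s, P s → Q s) :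
    liftable k g b P ≤ liftable k g b Q := by
  rintro f ⟨y, hy, hyf⟩
  exact ⟨y, fun s hs => h s (hy s hs), hyf⟩

/-- Liftability depends only on the image in `M`, so an element may be replaced by its reduction
modulo syzygies. -/
theorem mem_liftable_congr {g : Fin r → M} {b : Fin q → (Fin n →₀ ℕ) × Fin r}
    {P : (Fin n →₀ ℕ) × Fin q → Prop} {f f' : Fin r →₀ MvPolynomial (Fin n) k}
    (h : Finsupp.linearCombination (MvPolynomial (Fin n) k) g f =
      Finsupp.linearCombination (MvPolynomial (Fin n) k) g f') (hf : f ∈ liftable k g b P) :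
    f' ∈ liftable k g b P := by
  obtain ⟨y, hy, hyf⟩ := hf
  exact ⟨y, hy, hyf.trans h⟩

theorem term_mem_liftable_of_mul {g : Fin r → M} {b : Fin q → (Fin n →₀ ℕ) × Fin r}
    {P Q : (Fin n →₀ ℕ) × Fin q → Prop} {t : (Fin n →₀ ℕ) × Fin r} (γ : Fin n →₀ ℕ)
    (ht : term k t ∈ liftable k g b P) (hPQ : ∀ s, P s → Q (γ + s.1, s.2)) :
    term k (γ + t.1, t.2) ∈ liftable k g b Q := by
  obtain ⟨y, hy, hyf⟩ := ht
  refine ⟨monomial γ (1 : k) • y, fun s hs => ?_, ?_⟩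
  · obtain ⟨s', rfl, hs'⟩ := exists_of_termCoeff_monomial_smul_ne_zero hs
    exact hPQ s' (hy s' hs')
  · have : term k (γ + t.1, t.2) = monomial γ (1 : k) • term k t := by
      simp [term, monomial_mul]
    rw [this, map_smul, map_smul, hyf]

theorem IsTermOrder.irrefl {σ ι : Type*} {lt : (σ →₀ ℕ) × ι → (σ →₀ ℕ) × ι → Prop}
    (h : IsTermOrder lt) (t : (σ →₀ ℕ) × ι) : ¬ lt t t := by
  have := h.isWellOrder
  exact _root_.irrefl t

theorem IsTermOrder.trans {σ ι : Type*} {lt : (σ →₀ ℕ) × ι → (σ →₀ ℕ) × ι → Prop}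
    (h : IsTermOrder lt) {s t u : (σ →₀ ℕ) × ι} (h1 : lt s t) (h2 : lt t u) : lt s u := by
  have := h.isWellOrder
  exact _root_.trans h1 h2

/-! ### Reduction to standard terms -/

namespace HasLinearInitialTerms

variable {g : Fin r → M} {deg : Fin r → ℤ}
  {lt : (Fin n →₀ ℕ) × Fin r → (Fin n →₀ ℕ) × Fin r → Prop} {T : Set (Fin n × Fin r)}

/-- A nonstandard term is congruent to a combination of smaller terms of the same degree. -/
theorem exists_tail (H : HasLinearInitialTerms k g deg lt T) {p : Fin n × Fin r} (hp : p ∈ T)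
    (γ : Fin n →₀ ℕ) :
    ∃ F : Fin r →₀ MvPolynomial (Fin n) k,
      Finsupp.linearCombination (MvPolynomial (Fin n) k) g F =
        Finsupp.linearCombination (MvPolynomial (Fin n) k) g
          (term k (γ + Finsupp.single p.1 1, p.2)) ∧
      ∀ s, termCoeff F s ≠ 0 → lt s (γ + Finsupp.single p.1 1, p.2) ∧
        termDegree deg s = termDegree deg (γ + Finsupp.single p.1 1, p.2) ∧
        ∃ β, β ≠ 0 ∧ s.1 = γ + β := by
  classical
  obtain ⟨h, hK, hinit, hdeg⟩ := H.exists_initial p hp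
  set t : (Fin n →₀ ℕ) × Fin r := (γ + Finsupp.single p.1 1, p.2) with ht
  have hc : termCoeff h (Finsupp.single p.1 1, p.2) ≠ 0 := hinit.1
  set c := termCoeff h (Finsupp.single p.1 1, p.2) with hcdef
  -- Scaling by `c⁻¹` makes the leading coefficient of the multiple `1`, so `t` cancels and only the
  -- tail remains.
  refine ⟨term k t - monomial γ c⁻¹ • h, ?_, fun s hs => ?_⟩
  · rw [map_sub, map_smul, LinearMap.mem_ker.1 hK, smul_zero, sub_zero]
  · have hst : s ≠ t := by
      rintro rfl
      apply hs
      rw [termCoeff_sub, termCoeff_term, if_pos rfl, ht,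
        termCoeff_monomial_smul h γ c⁻¹ (Finsupp.single p.1 1, p.2), ← hcdef,
        inv_mul_cancel₀ hc, sub_self]
    rw [termCoeff_sub, termCoeff_term, if_neg hst.symm, zero_sub, neg_ne_zero] at hs
    obtain ⟨s', rfl, hs'⟩ := exists_of_termCoeff_monomial_smul_ne_zero hs
    refine ⟨?_, ?_, s'.1, (hdeg s' hs').2, rfl⟩
    · refine H.isTermOrder.mul_lt_mul γ _ _ _ _ (hinit.2 s' hs' ?_)
      rintro rfl
      exact hst rfl
    · have := (hdeg s' hs').1
      simp only [termDegree, map_add, Nat.cast_add, ht, Finsupp.degree_single] at this ⊢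
      push_cast
      linarith

/-- Every term of degree `d` is congruent to a combination of standard terms of degree `d` that
are not larger. -/
theorem term_mem_liftable (H : HasLinearInitialTerms k g deg lt T) {d : ℤ}
    {b : Fin q → (Fin n →₀ ℕ) × Fin r} (hb : IsStandardBasis deg T d b)
    (t : (Fin n →₀ ℕ) × Fin r) (ht : termDegree deg t = d) :
    term k t ∈ liftable k g b fun s => pushTerm b s = t ∨ lt (pushTerm b s) t := by
  classical
  have := H.isTermOrder.isWellOrder
  induction t using (IsWellFounded.wf (r := lt)).induction with
  | _ t ih =>
  by_cases hstd : IsStandard T t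
  · obtain ⟨a, rfl⟩ := hb.exists_eq t hstd ht
    have e : pushTerm b (0, a) = b a := by simp [pushTerm]
    refine ⟨term k (0, a), fun s hs => ?_, ?_⟩
    · rw [termCoeff_term] at hs
      obtain rfl : (0, a) = s := by by_contra h; simp [h] at hs
      exact Or.inl e
    · rw [← linearCombination_pushMap, pushMap_term, e]
  · obtain ⟨j, hj, hj0⟩ : ∃ j, (j, t.2) ∈ T ∧ t.1 j ≠ 0 := by
      simpa [IsStandard] using hstd
    obtain ⟨F, hF, hterms⟩ := H.exists_tail hj (t.1 - Finsupp.single j 1)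
    have e : (t.1 - Finsupp.single j 1 + Finsupp.single j 1, t.2) = t :=
      Prod.ext (tsub_add_cancel_of_le (by simpa [Nat.one_le_iff_ne_zero] using hj0)) rfl
    simp only [e] at hF hterms
    refine mem_liftable_congr hF (mem_of_forall_term_mem _ fun s hs => ?_)
    obtain ⟨hlt, hdeg, -⟩ := hterms s hs
    refine liftable_mono (fun s' hs' => Or.inr ?_) (ih s hlt (hdeg.trans ht))
    rcases hs' with rfl | hs'
    · exact hlt
    · exact H.isTermOrder.trans hs' hlt

end HasLinearInitialTerms

/-- The order on the terms of the free module on `b`: compare the terms `x^α · b a`, then the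
monomials in `b a`. -/
def pushOrder (lt : (Fin n →₀ ℕ) × Fin r → (Fin n →₀ ℕ) × Fin r → Prop)
    (b : Fin q → (Fin n →₀ ℕ) × Fin r) (s t : (Fin n →₀ ℕ) × Fin q) : Prop :=
  lt (pushTerm b s) (pushTerm b t) ∨
    pushTerm b s = pushTerm b t ∧ toLex (b s.2).1 < toLex (b t.2).1

/-- The order is pulled back from the lexicographic product of two well-orders. The pullback is
along an injection: the component and monomial of `b a` determine `a`, and cancelling that monomial
then recovers the coefficient. -/
theorem IsTermOrder.pushOrder {lt : (Fin n →₀ ℕ) × Fin r → (Fin n →₀ ℕ) × Fin r → Prop}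
    (h : IsTermOrder lt) {b : Fin q → (Fin n →₀ ℕ) × Fin r} (hb : Function.Injective b) :
    IsTermOrder (pushOrder lt b) where
  isWellOrder := by
    have := h.isWellOrder
    let φ : (Fin n →₀ ℕ) × Fin q ↪ ((Fin n →₀ ℕ) × Fin r) × Lex (Fin n →₀ ℕ) :=
      ⟨fun s => (pushTerm b s, toLex (b s.2).1), by
        rintro ⟨α, a⟩ ⟨β, a'⟩ hs
        simp only [pushTerm, Prod.mk.injEq, EmbeddingLike.apply_eq_iff_eq] at hs
        obtain ⟨⟨h1, h2⟩, h3⟩ := hs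
        obtain rfl : a = a' := hb (Prod.ext h3 h2)
        exact Prod.ext (add_right_cancel h1) rfl⟩
    have e : _root_.pushOrder lt b = Order.Preimage φ (Prod.Lex lt (· < ·)) := by
      funext s t
      simp only [_root_.pushOrder, Order.Preimage, Prod.lex_def]
      rfl
    rw [e]
    exact (RelEmbedding.preimage φ _).isWellOrder
  mul_lt_mul := by
    intro γ α β i j hs
    have e : ∀ (δ : Fin n →₀ ℕ) a, pushTerm b (γ + δ, a) =
        (γ + (pushTerm b (δ, a)).1, (pushTerm b (δ, a)).2) := fun δ a => by
      simp [pushTerm, add_assoc]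
    rcases hs with hs | ⟨hs, hs'⟩
    · left
      rw [e, e]
      exact h.mul_lt_mul _ _ _ _ _ hs
    · right
      refine ⟨?_, hs'⟩
      rw [e, e, hs]

/-- The initial linear syzygies of the standard terms of degree `d`. -/
def pushLinear (T : Set (Fin n × Fin r)) (b : Fin q → (Fin n →₀ ℕ) × Fin r) :
    Set (Fin n × Fin q) :=
  {p | (p.1, (b p.2).2) ∈ T ∨ ∃ l < p.1, (b p.2).1 l ≠ 0}

/-- For monomials of the same degree, `x^β < x^α` lexicographically forces a variable to occur more
often in `x^β` than in `x^α`, after one that occurs less often. -/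
theorem exists_lt_of_toLex_lt {α β : Fin n →₀ ℕ} (h : toLex β < toLex α)
    (hd : β.degree = α.degree) : ∃ p q, p < q ∧ α p ≠ 0 ∧ α q < β q := by
  obtain ⟨p, hp, hlt⟩ := Finsupp.Lex.lt_iff.1 h
  simp only [ofLex_toLex] at hp hlt
  by_contra! hcon
  rw [Finsupp.degree_eq_sum, Finsupp.degree_eq_sum] at hd
  -- Without such a variable, `β ≤ α` at every index and strictly at `p`, so the degrees would
  -- differ.
  refine hd.not_lt (Finset.sum_lt_sum (fun l _ => ?_) ⟨p, Finset.mem_univ _, hlt⟩)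
  rcases lt_trichotomy l p with hl | rfl | hl
  · exact (hp l hl).le
  · exact hlt.le
  · exact hcon p l hl (by omega)

/-! ### Initial terms of the new syzygies, minimality and generation -/

namespace HasLinearInitialTerms

variable {g : Fin r → M} {deg : Fin r → ℤ}
  {lt : (Fin n →₀ ℕ) × Fin r → (Fin n →₀ ℕ) × Fin r → Prop} {T : Set (Fin n × Fin r)}
  {d : ℤ} {b : Fin q → (Fin n →₀ ℕ) × Fin r}

theorem exists_dvd_pushOrder (H : HasLinearInitialTerms k g deg lt T)
    (hb : IsStandardBasis deg T d b) {f : Fin q →₀ MvPolynomial (Fin n) k}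
    (hf : f ∈ LinearMap.ker
      (Finsupp.linearCombination (MvPolynomial (Fin n) k) (termGenerator k g b)))
    {t : (Fin n →₀ ℕ) × Fin q} (ht : IsInitialTerm (pushOrder lt b) f t) :
    ∃ j, (j, t.2) ∈ pushLinear T b ∧ t.1 j ≠ 0 := by
  by_cases hex : ∃ s, termCoeff f s ≠ 0 ∧ pushTerm b s = pushTerm b t ∧ s ≠ t
  · obtain ⟨s, hs, hpush, hne⟩ := hex
    rcases ht.2 s hs hne with hlt | ⟨-, hlt⟩
    · exact absurd (hpush ▸ hlt) (H.isTermOrder.irrefl _)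
    have h1 : s.1 + (b s.2).1 = t.1 + (b t.2).1 := (Prod.ext_iff.1 hpush).1
    have h2 : (b s.2).2 = (b t.2).2 := (Prod.ext_iff.1 hpush).2
    have hd : (b s.2).1.degree = (b t.2).1.degree := by
      have := (hb.degree_eq s.2).trans (hb.degree_eq t.2).symm
      simp only [termDegree, h2] at this
      omega
    -- The variable `x_j` occurs more often in `b s.2` than in `b t.2`; as the products agree, it
    -- must occur in `t.1`.
    obtain ⟨p, j, hpj, hp, hj⟩ := exists_lt_of_toLex_lt hlt hd
    refine ⟨j, Or.inr ⟨p, hpj, hp⟩, ?_⟩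
    have := DFunLike.congr_fun h1 j
    simp only [Finsupp.add_apply] at this
    omega
  -- No collision at `t`: the pushed term survives and leads the old syzygy `pushMap k b f`.
  · push Not at hex
    have hK : pushMap k b f ∈
        LinearMap.ker (Finsupp.linearCombination (MvPolynomial (Fin n) k) g) := by
      rw [LinearMap.mem_ker, linearCombination_pushMap]
      exact hf
    have hinit : IsInitialTerm lt (pushMap k b f) (pushTerm b t) := by
      constructor
      · have := termCoeff_pushMap_pushTerm hex
        exact fun h0 => ht.1 (this.symm.trans h0)
      · intro u hu hne
        obtain ⟨s, hs, rfl⟩ := exists_of_termCoeff_pushMap_ne_zero hu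
        rcases ht.2 s hs (fun h => hne (by rw [h])) with hlt | ⟨heq, -⟩
        · exact hlt
        · exact absurd heq hne
    obtain ⟨j, hj, hj0⟩ := H.exists_dvd _ hK _ hinit
    refine ⟨j, Or.inl hj, ?_⟩
    have := hb.isStandard t.2 j hj
    simpa [pushTerm, this] using hj0

theorem isInitialTerm_term_sub (hlt : IsTermOrder lt) {y : Fin r →₀ MvPolynomial (Fin n) k}
    {t : (Fin n →₀ ℕ) × Fin r} (hy : ∀ s, termCoeff y s ≠ 0 → lt s t) :
    IsInitialTerm lt (term k t - y) t := by
  classical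
  constructor
  · have h0 : termCoeff y t = 0 := by
      by_contra h0
      exact hlt.irrefl _ (hy t h0)
    change termCoeff _ _ ≠ 0
    simp [termCoeff_sub, termCoeff_term, h0]
  · intro s hs hst
    change termCoeff _ _ ≠ 0 at hs
    rw [termCoeff_sub, termCoeff_term, if_neg (Ne.symm hst), zero_sub, neg_ne_zero] at hs
    exact hy s hs

/-- The tail of a syzygy with linear initial term lifts to the free module on the standard terms
of degree `d`. -/
theorem exists_lift_of_mem (H : HasLinearInitialTerms k g deg lt T)
    (hb : IsStandardBasis deg T d b) {j : Fin n} {a : Fin q} (hT : (j, (b a).2) ∈ T) :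
    ∃ y : Fin q →₀ MvPolynomial (Fin n) k,
      (∀ s, termCoeff y s ≠ 0 → pushOrder lt b s (Finsupp.single j 1, a)) ∧
      Finsupp.linearCombination (MvPolynomial (Fin n) k) (termGenerator k g b) y =
        Finsupp.linearCombination (MvPolynomial (Fin n) k) g
          (term k (pushTerm b (Finsupp.single j 1, a))) := by
  obtain ⟨F, hF, hterms⟩ := H.exists_tail hT (b a).1
  have e : pushTerm b (Finsupp.single j 1, a) = ((b a).1 + Finsupp.single j 1, (b a).2) := by
    simp [pushTerm, add_comm]
  have hdt : termDegree deg ((b a).1 + Finsupp.single j 1, (b a).2) = d + 1 := by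
    rw [← hb.degree_eq a]
    simp only [termDegree, map_add, Finsupp.degree_single, Nat.cast_add, Nat.cast_one]
    ring
  rw [← e] at hF hterms hdt
  have hmem : F ∈ liftable k g b fun s => lt (pushTerm b s) (pushTerm b (Finsupp.single j 1, a)) := by
    generalize pushTerm b (Finsupp.single j 1, a) = t at hF hterms hdt
    refine mem_of_forall_term_mem _ fun s hs => ?_
    obtain ⟨hlt, hdeg, β, hβ, hs1⟩ := hterms s hs
    -- Since `β ≠ 0`, a variable splits off the tail term and leaves a term of degree exactly `d`.
    -- Without this, the tail could contain a bare generator of degree `d + 1`.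
    obtain ⟨l, hl⟩ := Finsupp.ne_iff.1 hβ
    obtain ⟨α, i⟩ := s
    obtain ⟨γ, rfl⟩ : ∃ γ, α = Finsupp.single l 1 + γ := by
      refine exists_add_of_le ?_
      have : β l ≠ 0 := hl
      simp only at hs1
      rw [hs1, Finsupp.single_le_iff, Finsupp.add_apply]
      omega
    have hd : termDegree deg (γ, i) = d := by
      rw [hdt] at hdeg
      simp only [termDegree, map_add, Finsupp.degree_single, Nat.cast_add, Nat.cast_one] at hdeg ⊢
      linarith
    refine term_mem_liftable_of_mul (t := (γ, i)) (Finsupp.single l 1)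
      (H.term_mem_liftable hb _ hd) fun s' hs' => ?_
    have e' : pushTerm b (Finsupp.single l 1 + s'.1, s'.2) =
        (Finsupp.single l 1 + (pushTerm b s').1, (pushTerm b s').2) := by
      simp [pushTerm, add_assoc]
    rw [e']
    rcases hs' with hs' | hs'
    · rw [hs']
      exact hlt
    · exact H.isTermOrder.trans (H.isTermOrder.mul_lt_mul _ _ _ _ _ hs') hlt
  obtain ⟨y, hy, hyF⟩ := hmem
  exact ⟨y, fun s hs => Or.inl (hy s hs), hyF.trans hF⟩

/-- Moving a variable `x_l` of `b a` to an earlier place in the lexicographic order. -/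
theorem exists_lift_of_lt (hb : IsStandardBasis deg T d b) {j l : Fin n} {a : Fin q}
    (hT : (j, (b a).2) ∉ T) (hlj : l < j) (hl : (b a).1 l ≠ 0) :
    ∃ y : Fin q →₀ MvPolynomial (Fin n) k,
      (∀ s, termCoeff y s ≠ 0 → pushOrder lt b s (Finsupp.single j 1, a)) ∧
      Finsupp.linearCombination (MvPolynomial (Fin n) k) (termGenerator k g b) y =
        Finsupp.linearCombination (MvPolynomial (Fin n) k) g
          (term k (pushTerm b (Finsupp.single j 1, a))) := by
  classical
  have hle : Finsupp.single l 1 ≤ (b a).1 := by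
    simpa [Nat.one_le_iff_ne_zero] using hl
  obtain ⟨γ, hγ⟩ := exists_add_of_le hle
  -- Replacing `x_l` by `x_j` keeps the term standard: only `x_j` can be a new variable, and `(j, (b
  -- a).2) ∉ T`.
  have hstd : IsStandard T (Finsupp.single j 1 + γ, (b a).2) := by
    intro j' hj'
    have h0 := hb.isStandard a j' hj'
    have hne : j ≠ j' := by
      rintro rfl
      exact hT hj'
    rw [hγ, Finsupp.add_apply] at h0
    rw [Finsupp.add_apply, Finsupp.single_apply, if_neg hne, (Nat.add_eq_zero_iff.1 h0).2]
  have hdeg : termDegree deg (Finsupp.single j 1 + γ, (b a).2) = d := by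
    rw [← hb.degree_eq a]
    simp only [termDegree, hγ, map_add, Finsupp.degree_single]
  obtain ⟨a', ha'⟩ := hb.exists_eq _ hstd hdeg
  have hpush : pushTerm b (Finsupp.single l 1, a') = pushTerm b (Finsupp.single j 1, a) := by
    simp only [pushTerm, ha', hγ]
    rw [add_left_comm]
  refine ⟨term k (Finsupp.single l 1, a'), fun s hs => ?_, ?_⟩
  · rw [termCoeff_term] at hs
    obtain rfl : (Finsupp.single l 1, a') = s := by by_contra h; simp [h] at hs
    -- The old terms coincide, so the tie-break decides: the first change of exponent is the loss of
    -- `x_l`, as `l < j`.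
    refine Or.inr ⟨hpush, Finsupp.Lex.lt_iff.2 ⟨l, fun m hm => ?_, ?_⟩⟩
    · simp [ha', hγ, hm.ne', (hm.trans hlj).ne']
    · simp [ha', hγ, hlj.ne']
  · rw [← linearCombination_pushMap, pushMap_term, hpush]

theorem exists_isInitialTerm_pushOrder (H : HasLinearInitialTerms k g deg lt T)
    (hb : IsStandardBasis deg T d b) {p : Fin n × Fin q} (hp : p ∈ pushLinear T b) :
    ∃ f ∈ LinearMap.ker
        (Finsupp.linearCombination (MvPolynomial (Fin n) k) (termGenerator k g b)),
      IsInitialTerm (pushOrder lt b) f (Finsupp.single p.1 1, p.2) := by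
  obtain ⟨j, a⟩ := p
  obtain ⟨y, hy, hyt⟩ : ∃ y : Fin q →₀ MvPolynomial (Fin n) k,
      (∀ s, termCoeff y s ≠ 0 → pushOrder lt b s (Finsupp.single j 1, a)) ∧
      Finsupp.linearCombination (MvPolynomial (Fin n) k) (termGenerator k g b) y =
        Finsupp.linearCombination (MvPolynomial (Fin n) k) g
          (term k (pushTerm b (Finsupp.single j 1, a))) := by
    by_cases hT : (j, (b a).2) ∈ T
    · exact H.exists_lift_of_mem hb hT
    · obtain ⟨l, hlj, hl⟩ := hp.resolve_left hT
      exact exists_lift_of_lt hb hT hlj hl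
  refine ⟨term k (Finsupp.single j 1, a) - y, ?_,
    isInitialTerm_term_sub (H.isTermOrder.pushOrder hb.injective) hy⟩
  rw [LinearMap.mem_ker, map_sub, hyt, ← linearCombination_pushMap, pushMap_term, sub_self]

/-- The standard terms of degree `d` are linearly independent in `M`. -/
theorem termCoeff_zero_eq_zero {𝓜 : ℤ → AddSubgroup M}
    (h𝓜 : IsGradedModule (k := k) (n := n) 𝓜) (H : HasLinearInitialTerms k g deg lt T)
    (hb : IsStandardBasis deg T d b) (hgen : ∀ a, termGenerator k g b a ∈ 𝓜 d)
    {f : Fin q →₀ MvPolynomial (Fin n) k}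
    (hf : f ∈ LinearMap.ker
      (Finsupp.linearCombination (MvPolynomial (Fin n) k) (termGenerator k g b)))
    (a : Fin q) : termCoeff f (0, a) = 0 := by
  obtain ⟨π, -, hπ⟩ := h𝓜.exists_component d
  -- All new generators have degree `d`, so the component of degree `d` is exactly the constant part
  -- of `f`.
  obtain ⟨f', hf', hcoeff⟩ := hπ (termGenerator k g b) (fun _ => d) hgen f
  have hconst : ∀ s, termCoeff f' s ≠ 0 → s.1 = 0 := by
    intro s hs
    rw [hcoeff] at hs
    have : termDegree (fun _ => d) s = d := by
      by_contra h
      simp [h] at hs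
    simpa [termDegree, Finsupp.degree_eq_zero_iff] using this
  have hK : pushMap k b f' ∈
      LinearMap.ker (Finsupp.linearCombination (MvPolynomial (Fin n) k) g) := by
    rw [LinearMap.mem_ker, linearCombination_pushMap, hf', LinearMap.mem_ker.1 hf, map_zero]
  -- A combination of standard terms has a standard initial term, which is impossible for a nonzero
  -- syzygy.
  have hzero : pushMap k b f' = 0 := by
    by_contra hne
    obtain ⟨t, ht⟩ := H.isTermOrder.exists_isInitialTerm hne
    obtain ⟨j, hj, hj0⟩ := H.exists_dvd _ hK t ht
    obtain ⟨s, hs, rfl⟩ := exists_of_termCoeff_pushMap_ne_zero ht.1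
    have := hb.isStandard s.2 j hj
    simp [pushTerm, hconst s hs, this] at hj0
  have hpush : termCoeff (pushMap k b f') (pushTerm b (0, a)) = termCoeff f' (0, a) := by
    refine termCoeff_pushMap_pushTerm fun s hs heq => ?_
    obtain ⟨α, a'⟩ := s
    obtain rfl : α = 0 := hconst _ hs
    have : b a' = b a := by simpa [pushTerm, Prod.ext_iff] using heq
    rw [hb.injective this]
  rw [hzero, hcoeff, if_pos (by simp [termDegree])] at hpush
  rw [← hpush]
  simp [termCoeff]

theorem span_termGenerator {𝓜 : ℤ → AddSubgroup M}
    (h𝓜 : IsGradedModule (k := k) (n := n) 𝓜) (H : HasLinearInitialTerms k g deg lt T)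
    (hb : IsStandardBasis deg T d b) (hg : ∀ i, g i ∈ 𝓜 (deg i))
    (hspan : Submodule.span (MvPolynomial (Fin n) k) (Set.range g) = ⊤)
    (hgen : ∀ a, termGenerator k g b a ∈ 𝓜 d) :
    Submodule.span (MvPolynomial (Fin n) k) (Set.range (termGenerator k g b)) =
      degreeComponent (MvPolynomial (Fin n) k) 𝓜 d := by
  apply le_antisymm
  · refine Submodule.span_mono ?_
    rintro _ ⟨a, rfl⟩
    exact hgen a
  · refine Submodule.span_le.2 fun x hx => ?_
    have hx' : x ∈ Submodule.span (MvPolynomial (Fin n) k) (Set.range g) := hspan ▸ trivial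
    rw [← Finsupp.range_linearCombination] at hx'
    obtain ⟨f, rfl⟩ := hx'
    obtain ⟨π, hπ1, hπ⟩ := h𝓜.exists_component d
    obtain ⟨f', hf', hcoeff⟩ := hπ g deg hg f
    rw [hπ1 _ hx] at hf'
    have hmem : f' ∈ liftable k g b fun _ => True := by
      refine mem_of_forall_term_mem _ fun s hs => ?_
      rw [hcoeff] at hs
      exact liftable_mono (fun _ _ => trivial) (H.term_mem_liftable hb s (by
        by_contra h
        simp [h] at hs))
    obtain ⟨y, -, hy⟩ := hmem
    rw [← hf', ← hy, ← Finsupp.range_linearCombination]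
    exact ⟨y, rfl⟩

end HasLinearInitialTerms

/-- The syzygies of a presentation with initially linear syzygies are graded, hence the linear
initial terms are initial terms of homogeneous syzygies. -/
theorem IsInitiallyLinearPresentation.hasLinearInitialTerms {𝓜 : ℤ → AddSubgroup M}
    (h𝓜 : IsGradedModule (k := k) (n := n) 𝓜) {g : Fin r → M}
    {lt : (Fin n →₀ ℕ) × Fin r → (Fin n →₀ ℕ) × Fin r → Prop}
    (h : IsInitiallyLinearPresentation (k := k) 𝓜 g lt) {deg : Fin r → ℤ}
    (hdeg : ∀ i, g i ∈ 𝓜 (deg i)) : ∃ T, HasLinearInitialTerms k g deg lt T := by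
  obtain ⟨T, hT⟩ := h.initiallyLinear
  have hmin : ∀ f ∈ LinearMap.ker (Finsupp.linearCombination (MvPolynomial (Fin n) k) g),
      ∀ i, termCoeff f (0, i) = 0 := fun f hf i => mem_idealOfVars_iff.1 (h.minimal f hf i)
  obtain ⟨h1, h2⟩ := linear_terms_of_initialModule_eq hmin hT
  refine ⟨T, h.isTermOrder, fun p hp => ?_, h2⟩
  obtain ⟨f, hf, hinit⟩ := h1 p hp
  -- `deg p.2 + 1` is the degree of the linear initial term, so this component of the syzygy keeps
  -- it.
  obtain ⟨π, -, hπ⟩ := h𝓜.exists_component (deg p.2 + 1)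
  obtain ⟨f', hf', hcoeff⟩ := hπ g deg hdeg f
  have hK : f' ∈ LinearMap.ker (Finsupp.linearCombination (MvPolynomial (Fin n) k) g) := by
    rw [LinearMap.mem_ker, hf', LinearMap.mem_ker.1 hf, map_zero]
  have key : ∀ s, termCoeff f' s ≠ 0 → termDegree deg s = deg p.2 + 1 ∧ termCoeff f s ≠ 0 := by
    intro s hs
    rw [hcoeff] at hs
    split_ifs at hs with hd
    · exact ⟨hd, hs⟩
    · exact absurd rfl hs
  refine ⟨f', hK, ⟨?_, fun s hs hne => hinit.2 s (key s hs).2 hne⟩, fun s hs => ⟨(key s hs).1, ?_⟩⟩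
  · change termCoeff f' _ ≠ 0
    rw [hcoeff, if_pos (by simp [termDegree, add_comm])]
    exact hinit.1
  · obtain ⟨α, i⟩ := s
    rintro rfl
    exact hs (hmin f' hK i)

end LinearSyzygies

theorem mainTheorem3 {k : Type*} [Field k] {n : ℕ} {M : Type*} [AddCommGroup M]
    [Module (MvPolynomial (Fin n) k) M] [Module.Finite (MvPolynomial (Fin n) k) M]
    (𝓜 : ℤ → AddSubgroup M) (h𝓜 : IsGradedModule (k := k) (n := n) 𝓜)
    (hM : HasInitiallyLinearSyzygies k n 𝓜) (d : ℤ) :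
    HasInitiallyLinearSyzygies k n
      (inheritedGrading 𝓜 (degreeComponent (MvPolynomial (Fin n) k) 𝓜 d)) := by
  obtain ⟨r, g, lt, h⟩ := hM
  choose deg hdeg using h.homogeneous
  obtain ⟨T, H⟩ := h.hasLinearInitialTerms h𝓜 hdeg
  obtain ⟨q, b, hb⟩ := exists_isStandardBasis deg T d
  have hgen : ∀ a, termGenerator k g b a ∈ 𝓜 d := fun a => by
    rw [← hb.degree_eq a]
    exact h𝓜.smul_mem _ _ _ _ (isHomogeneous_monomial 1 rfl) (hdeg _)
  set N := degreeComponent (MvPolynomial (Fin n) k) 𝓜 d with hN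
  let g' : Fin q → N := fun a => ⟨termGenerator k g b a, Submodule.subset_span (hgen a)⟩
  have hlin : (Finsupp.linearCombination (MvPolynomial (Fin n) k) (termGenerator k g b)) =
      N.subtype.comp (Finsupp.linearCombination (MvPolynomial (Fin n) k) g') := by
    ext a
    simp [g']
  have hker : LinearMap.ker (Finsupp.linearCombination (MvPolynomial (Fin n) k) g') =
      LinearMap.ker (Finsupp.linearCombination (MvPolynomial (Fin n) k) (termGenerator k g b)) := by
    -- The inclusion of `M_⟨d⟩` in `M` is injective, so the syzygies can be computed in `M`.
    rw [hlin, LinearMap.ker_comp_of_ker_eq_bot _ N.ker_subtype]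
  refine ⟨q, g', pushOrder lt b, H.isTermOrder.pushOrder hb.injective, fun a => ⟨d, hgen a⟩,
    ?_, ?_, pushLinear T b, ?_⟩
  · apply Submodule.map_injective_of_injective N.injective_subtype
    rw [Submodule.map_span, ← Set.range_comp, Submodule.map_top, Submodule.range_subtype]
    exact H.span_termGenerator h𝓜 hb hdeg h.span_eq_top hgen
  · rw [hker]
    exact fun f hf i => mem_idealOfVars_iff.2 (H.termCoeff_zero_eq_zero h𝓜 hb hgen hf i)
  · rw [hker]
    exact initialModule_eq_span_linear (fun p hp => H.exists_isInitialTerm_pushOrder hb hp)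
      fun f hf t ht => H.exists_dvd_pushOrder hb hf ht
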